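/- Let $\mathbb K$ be a field of characteristic zero, let $X$ be a smooth projective (integral) curve over $\mathbb K$ with function field $\mathbb K(X)$, and let $n\ge 0$ be an integer. For $f\in\mathbb K(X)^\times$ let $(f)=\sum_x \operatorname{ord}_x(f)[x]$ be its divisor, the sum being over the closed points $x$ of $X$; two divisors are called disjoint if their supports are disjoint. Let $V(X)$ be the $\mathbb Q$-vector space generated by the symbols $\langle f_1,\dots,f_n\rangle$, where $f_1,\dots,f_n\in\mathbb K(X)^\times$ have pairwise disjoint divisors, modulo the following relations: 1. $\langle f_{\sigma(1)},\dots,f_{\sigma(n)}\rangle=\operatorname{sgn}(\sigma)\,\langle f_1,\dots,f_n\rangle$ for every permutation $\sigma$ of $\{1,\dots,n\}$; 2. $\langle g_1g_2,f_2,\dots,f_n\rangle=\langle g_1,f_2,\dots,f_n\rangle+\langle g_2,f_2,\dots,f_n\rangle$ (for $n\ge 1$) whenever the divisors $(f_2),\dots,(f_n)$ are pairwise disjoint and each of $(g_1),(g_2)$ is disjoint from each of $(f_2),\dots,(f_n)$. Then the $\mathbb Q$-linear map $$\theta\colon V(X)\to\Lambda^n_{\mathbb Q}\bigl(\mathbb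 K(X)^\times\otimes_{\mathbb Z}\mathbb Q\bigr),\qquad \theta(\langle f_1,\dots,f_n\rangle)=f_1\wedge\dots\wedge f_n,$$ is well defined and is an isomorphism. -/

import Mathlib

open AlgebraicGeometry CategoryTheory
open scoped TensorProduct

noncomputable section

namespace DisjointDivisors

universe u

attribute [local instance] MvPolynomial.gradedAlgebra

/-- Projective `N`-space over a field `K`: the `Proj` of the polynomial ring in `N + 1` variables
with its standard grading. -/
abbrev projectiveSpace (K : Type u) [Field K] (N : ℕ) : Scheme.{u} :=
  Proj (MvPolynomial.homogeneousSubmodule (Fin (N + 1)) K)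

/-- The structure morphism from projective space to `Spec K`, given by the inclusion of `K` into the
degree zero part of the polynomial ring. -/
def projectiveSpaceToSpec (K : Type u) [Field K] (N : ℕ) :
    projectiveSpace K N ⟶ Spec (CommRingCat.of K) :=
  Proj.toSpecZero (MvPolynomial.homogeneousSubmodule (Fin (N + 1)) K) ≫
    Spec.map (CommRingCat.ofHom
      (algebraMap K (MvPolynomial.homogeneousSubmodule (Fin (N + 1)) K 0)))

/-- A smooth projective curve over a field `K`: an integral scheme, smooth of relative dimension one
over `K`, that admits a closed immersion over `K` into some projective space. -/
structure SmoothProjectiveCurve (K : Type u) [Field K] where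
  toScheme : Scheme.{u}
  structureMorphism : toScheme ⟶ Spec (CommRingCat.of K)
  isIntegral : IsIntegral toScheme
  smooth : SmoothOfRelativeDimension 1 structureMorphism
  projective : ∃ (N : ℕ) (i : toScheme ⟶ projectiveSpace K N),
    IsClosedImmersion i ∧ i ≫ projectiveSpaceToSpec K N = structureMorphism

variable {K : Type u} [Field K]

instance (X : SmoothProjectiveCurve K) : IsIntegral X.toScheme := X.isIntegral

instance (X : SmoothProjectiveCurve K) :
    SmoothOfRelativeDimension 1 X.structureMorphism := X.smooth

instance (X : SmoothProjectiveCurve K) : IsLocallyNoetherian X.toScheme :=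
  haveI : Smooth X.structureMorphism := SmoothOfRelativeDimension.smooth 1 X.structureMorphism
  LocallyOfFiniteType.isLocallyNoetherian X.structureMorphism

/-- The multiplicative group of non-zero rational functions on `X`. -/
abbrev RatFun (X : SmoothProjectiveCurve K) : Type u := (X.toScheme.functionField)ˣ

/-- The support of the divisor of `f`: the codimension one points `x` at which the order
`ord_x f` is not zero (Mathlib's `Scheme.ord` is `0` at all points of another codimension). -/
def divSupport {X : SmoothProjectiveCurve K} (f : RatFun X) : Set X.toScheme :=
  Function.support (Scheme.ord (f : X.toScheme.functionField))

/-- The sequences `(f₁, …, fₙ)` of non-zero rational functions with pairwise disjoint divisors. -/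
@[ext]
structure DisjointTuple (X : SmoothProjectiveCurve K) (n : ℕ) where
  fn : Fin n → RatFun X
  disjoint : ∀ i j, i ≠ j → Disjoint (divSupport (fn i)) (divSupport (fn j))

/-- The sequence `(f_{σ(1)}, …, f_{σ(n)})`. -/
def DisjointTuple.perm {X : SmoothProjectiveCurve K} {n : ℕ} (f : DisjointTuple X n)
    (σ : Equiv.Perm (Fin n)) : DisjointTuple X n :=
  ⟨fun i => f.fn (σ i), fun _ _ hij => f.disjoint _ _ (σ.injective.ne hij)⟩

/-- The defining relations of `V(X)`. -/
inductive VRel (X : SmoothProjectiveCurve K) (n : ℕ) : (DisjointTuple X n →₀ ℚ) → Prop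
  /-- `⟨f_{σ(1)}, …, f_{σ(n)}⟩ = sgn(σ) ⟨f₁, …, fₙ⟩`. -/
  | antisymm (f : DisjointTuple X n) (σ : Equiv.Perm (Fin n)) :
      VRel X n (Finsupp.single (f.perm σ) 1 -
        ((Equiv.Perm.sign σ : ℤ) : ℚ) • Finsupp.single f 1)
  /-- `⟨g₁g₂, f₂, …, fₙ⟩ = ⟨g₁, f₂, …, fₙ⟩ + ⟨g₂, f₂, …, fₙ⟩`, where `i` is the first index,
  `a = (g₁, f₂, …, fₙ)`, `b = (g₂, f₂, …, fₙ)` and `c = (g₁g₂, f₂, …, fₙ)`. -/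
  | mul (i : Fin n) (hi : (i : ℕ) = 0) (a b c : DisjointTuple X n)
      (hc : c.fn i = a.fn i * b.fn i) (hab : ∀ j, j ≠ i → b.fn j = a.fn j)
      (hac : ∀ j, j ≠ i → c.fn j = a.fn j) :
      VRel X n (Finsupp.single c 1 - (Finsupp.single a 1 + Finsupp.single b 1))

/-- The `ℚ`-vector space `V(X)` (in degree `n`). -/
abbrev V (X : SmoothProjectiveCurve K) (n : ℕ) : Type u :=
  (DisjointTuple X n →₀ ℚ) ⧸ Submodule.span ℚ {r | VRel X n r}

/-- `K(X)ˣ ⊗ ℚ`. -/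
abbrev RatFunQ (X : SmoothProjectiveCurve K) : Type u := ℚ ⊗[ℤ] Additive (RatFun X)

/-- `f₁ ∧ … ∧ fₙ` in the `n`-th exterior power over `ℚ` of `K(X)ˣ ⊗ ℚ`. -/
def wedge (X : SmoothProjectiveCurve K) (n : ℕ) (f : Fin n → RatFun X) :
    ⋀[ℚ]^n (RatFunQ X) :=
  exteriorPower.ιMulti ℚ n fun i => (1 : ℚ) ⊗ₜ[ℤ] Additive.ofMul (f i)

theorem wedge_mul (X : SmoothProjectiveCurve K) (n : ℕ) (i : Fin n) (a b c : Fin n → RatFun X)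
    (hc : c i = a i * b i) (hab : ∀ j, j ≠ i → b j = a j) (hac : ∀ j, j ≠ i → c j = a j) :
    wedge X n c = wedge X n a + wedge X n b := by
  let t : RatFun X → RatFunQ X := fun f => (1 : ℚ) ⊗ₜ[ℤ] Additive.ofMul f
  have key (d : Fin n → RatFun X) (hd : ∀ j, j ≠ i → d j = a j) :
      (fun j => t (d j)) = Function.update (fun j => t (a j)) i (t (d i)) := by
    funext j
    by_cases hj : j = i
    · subst hj; simp
    · simp [hj, hd j hj]
  have ht : t (c i) = t (a i) + t (b i) := by
    simp only [t, hc, ofMul_mul, TensorProduct.tmul_add]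
  change exteriorPower.ιMulti ℚ n (fun j => t (c j)) =
    exteriorPower.ιMulti ℚ n (fun j => t (a j)) + exteriorPower.ιMulti ℚ n (fun j => t (b j))
  rw [key c hac, key b hab, ht, AlternatingMap.map_update_add, Function.update_eq_self]

/-- The natural map `θ : V(X) → Λⁿ(K(X)ˣ ⊗ ℚ)`, `⟨f₁, …, fₙ⟩ ↦ f₁ ∧ … ∧ fₙ`. -/
def theta (X : SmoothProjectiveCurve K) (n : ℕ) : V X n →ₗ[ℚ] ⋀[ℚ]^n (RatFunQ X) :=
  Submodule.liftQ _
    (Finsupp.linearCombination ℚ fun f : DisjointTuple X n => wedge X n f.fn) <| by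
    rw [Submodule.span_le]
    rintro r (⟨f, σ⟩ | ⟨i, hi, a, b, c, hc, hab, hac⟩)
    · have h : wedge X n (f.perm σ).fn = ((Equiv.Perm.sign σ : ℤ) : ℚ) • wedge X n f.fn := by
        refine (AlternatingMap.map_perm (exteriorPower.ιMulti ℚ n)
          (fun i => (1 : ℚ) ⊗ₜ[ℤ] Additive.ofMul (f.fn i)) σ).trans ?_
        exact (Int.cast_smul_eq_zsmul ℚ _ _).symm
      simp [h]
    · have h := wedge_mul X n i a.fn b.fn c.fn hc hab hac
      simp [h]

end DisjointDivisors

end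

/-! Fix finitely many functions and a finite set `S` of codimension one points containing their
zeros and poles. The curve is projective over an infinite field, so some hyperplane misses `S` and
`S` lies in an affine open. Prime avoidance there gives functions with a zero at one point of `S`
and order zero at the others. Choosing them successively yields a family `t i x` (`i : Fin n`, `x ∈
S`) of common order `M ≠ 0` at `x`, of order zero on the rest of `S`, with no two divisors meeting
outside `S`.

Written additively, `M • f = ∑ x, ord_x f • t i x + r`, where `r` has order zero on all of `S`.
Expand each slot `i` in this way with its own functions `t i x`. A term of the product expansion has
pairwise disjoint divisors as soon as no point of `S` is used in two slots.

Surjectivity: expand `M ^ n • (f₁ ∧ … ∧ fₙ)` and average over permutations of the `fₖ`. Terms using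
a point twice cancel in pairs (`sum_perm_eq_zero`); the others are images of symbols.

Injectivity: the sum of the symbols of the good terms is multilinear in arbitrary functions
supported in `S`. On a disjoint tuple it equals `M ^ n` times the symbol (`extendedSymbol_apply`),
and antisymmetrizing gives a left inverse of `theta` up to the factor `n! * M ^ n`, on the symbols
supported in `S`. Every element of `V X n` involves finitely many functions, so this is enough. -/

noncomputable section

namespace DisjointDivisors

universe u

/-! ### Calculus of symbols -/

section Symbols

variable {K : Type u} [Field K] {X : SmoothProjectiveCurve K} {n : ℕ}

/-- The class of a symbol in `V(X)`. -/
def symbol (f : DisjointTuple X n) : V X n :=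
  Submodule.Quotient.mk (Finsupp.single f 1)

theorem theta_symbol (f : DisjointTuple X n) : theta X n (symbol f) = wedge X n f.fn := by
  simp [theta, symbol]

theorem symbol_perm (f : DisjointTuple X n) (σ : Equiv.Perm (Fin n)) :
    symbol (f.perm σ) = ((Equiv.Perm.sign σ : ℤ) : ℚ) • symbol f := by
  rw [symbol, symbol, ← Submodule.Quotient.mk_smul, Submodule.Quotient.eq]
  exact Submodule.subset_span (VRel.antisymm f σ)

/-- Antisymmetry under a transposition carries the relation from the first slot to every slot. -/
theorem symbol_mul (i : Fin n) (a b c : DisjointTuple X n)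
    (hc : c.fn i = a.fn i * b.fn i) (hab : ∀ j, j ≠ i → b.fn j = a.fn j)
    (hac : ∀ j, j ≠ i → c.fn j = a.fn j) : symbol c = symbol a + symbol b := by
  have h0 : 0 < n := i.pos
  let z : Fin n := ⟨0, h0⟩
  let σ := Equiv.swap z i
  have hz (j : Fin n) (hj : j ≠ z) : σ j ≠ i := by
    intro h
    apply hj
    rw [← σ.injective.eq_iff, h]
    simp [σ]
  have key : symbol (c.perm σ) = symbol (a.perm σ) + symbol (b.perm σ) := by
    rw [symbol, symbol, symbol, ← Submodule.Quotient.mk_add, Submodule.Quotient.eq]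
    refine Submodule.subset_span (VRel.mul z rfl _ _ _ ?_ ?_ ?_)
    · simpa [DisjointTuple.perm, σ] using hc
    · exact fun j hj => hab _ (hz j hj)
    · exact fun j hj => hac _ (hz j hj)
  rw [symbol_perm, symbol_perm, symbol_perm, ← smul_add] at key
  have hs : ((Equiv.Perm.sign σ : ℤ) : ℚ) ≠ 0 := by
    exact_mod_cast (Equiv.Perm.sign σ).ne_zero
  exact smul_right_injective _ hs key

/-- The order at a point, as an additive homomorphism. -/
def ordLin (X : SmoothProjectiveCurve K) (x : X.toScheme) : Additive (RatFun X) →ₗ[ℤ] ℤ :=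
  AddMonoidHom.toIntLinearMap
    { toFun := fun f => Scheme.ord (f.toMul : X.toScheme.functionField) x
      map_zero' := by
        have h := Scheme.ord_mul (x := x) (one_ne_zero (α := X.toScheme.functionField))
          (one_ne_zero (α := X.toScheme.functionField))
        rw [mul_one] at h
        exact left_eq_add.1 h
      map_add' := fun f g => by
        simp }

theorem mem_divSupport {f : RatFun X} {x : X.toScheme} :
    x ∈ divSupport f ↔ ordLin X x (Additive.ofMul f) ≠ 0 := Iff.rfl

/-- The functions whose divisor is supported in a set of points. -/
def supportedIn (X : SmoothProjectiveCurve K) (Y : Set X.toScheme) :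
    Submodule ℤ (Additive (RatFun X)) :=
  ⨅ x ∈ Yᶜ, LinearMap.ker (ordLin X x)

theorem mem_supportedIn {Y : Set X.toScheme} {f : Additive (RatFun X)} :
    f ∈ supportedIn X Y ↔ ∀ x, x ∉ Y → ordLin X x f = 0 := by
  simp [supportedIn]

theorem mem_supportedIn_iff {Y : Set X.toScheme} {f : Additive (RatFun X)} :
    f ∈ supportedIn X Y ↔ divSupport f.toMul ⊆ Y := by
  rw [mem_supportedIn]
  refine forall_congr' fun x => ?_
  rw [mem_divSupport, not_imp_comm]
  rfl

/-- The tuple attached to functions supported in pairwise disjoint sets. -/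
def tupleOf {Y : Fin n → Set X.toScheme} (hY : ∀ i j, i ≠ j → Disjoint (Y i) (Y j))
    (g : ∀ i, supportedIn X (Y i)) : DisjointTuple X n :=
  ⟨fun i => (g i : Additive (RatFun X)).toMul, fun i j hij =>
    (hY i j hij).mono (mem_supportedIn_iff.1 (g i).2) (mem_supportedIn_iff.1 (g j).2)⟩

/-- Symbols of functions supported in fixed pairwise disjoint sets are multilinear. -/
def symbolMultilinear {Y : Fin n → Set X.toScheme} (hY : ∀ i j, i ≠ j → Disjoint (Y i) (Y j)) :
    MultilinearMap ℤ (fun i => supportedIn X (Y i)) (V X n) :=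
  have hadd (inst : DecidableEq (Fin n)) (m : ∀ i, supportedIn X (Y i)) (i : Fin n)
      (x y : supportedIn X (Y i)) :
      symbol (tupleOf hY (Function.update m i (x + y))) =
        symbol (tupleOf hY (Function.update m i x)) +
          symbol (tupleOf hY (Function.update m i y)) := by
    refine symbol_mul i _ _ _ ?_ ?_ ?_
    · simp [tupleOf]
    · intro j hj; simp [tupleOf, hj]
    · intro j hj; simp [tupleOf, hj]
  { toFun := fun g => symbol (tupleOf hY g)
    map_update_add' := fun m i x y => hadd _ m i x y
    -- Compatibility with integer scalars is automatic for an additive map.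
    map_update_smul' := fun {inst} m i c x =>
      map_zsmul (AddMonoidHom.mk' (fun x => symbol (tupleOf hY (Function.update m i x)))
        (hadd inst m i)) c x }

theorem symbolMultilinear_apply {Y : Fin n → Set X.toScheme}
    (hY : ∀ i j, i ≠ j → Disjoint (Y i) (Y j)) (g : ∀ i, supportedIn X (Y i)) :
    symbolMultilinear hY g = symbol (tupleOf hY g) := rfl

/-- The symbol does not depend on the sets bounding the supports, so symbols built from different
choices of `Y` can be compared. -/
theorem symbolMultilinear_eq_symbol {Y : Fin n → Set X.toScheme}
    (hY : ∀ i j, i ≠ j → Disjoint (Y i) (Y j)) (g : ∀ i, supportedIn X (Y i))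
    (d : DisjointTuple X n) (h : ∀ i, (g i : Additive (RatFun X)) = Additive.ofMul (d.fn i)) :
    symbolMultilinear hY g = symbol d := by
  rw [symbolMultilinear_apply]
  exact congrArg symbol (DisjointTuple.ext (funext h))

end Symbols

/-! ### Extending multilinear maps from ℤ to ℚ -/

section Extension

/-- Induction on `n`: curry off the first variable and base change the resulting linear map.
Linearity of `E` is part of the claim so that `E` can be composed with `curryLeft`. -/
theorem exists_multilinear_baseChange (H M : Type*) [AddCommGroup H] [AddCommGroup M]
    [Module ℚ M] (n : ℕ) :
    ∃ E : MultilinearMap ℤ (fun _ : Fin n => H) M →ₗ[ℤ]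
        MultilinearMap ℚ (fun _ : Fin n => ℚ ⊗[ℤ] H) M,
      ∀ f h, E f (fun i => (1 : ℚ) ⊗ₜ[ℤ] h i) = f h := by
  induction n with
  | zero =>
    refine ⟨AddMonoidHom.toIntLinearMap
      { toFun := fun f => MultilinearMap.constOfIsEmpty ℚ _ (f 0)
        map_zero' := by ext; simp
        map_add' := fun f g => by ext; simp }, fun f h => ?_⟩
    simp [Subsingleton.elim h 0]
  | succ n ih =>
    obtain ⟨E, hE⟩ := ih
    let c : MultilinearMap ℤ (fun _ : Fin (n + 1) => H) M →+
        (ℚ ⊗[ℤ] H →ₗ[ℚ] MultilinearMap ℚ (fun _ : Fin n => ℚ ⊗[ℤ] H) M) :=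
      AddMonoidHom.mk' (fun f => (E ∘ₗ f.curryLeft).liftBaseChange ℚ) fun f g => by
        ext x : 3
        simp only [TensorProduct.AlgebraTensorModule.curry_apply,
          TensorProduct.curry_apply, LinearMap.liftBaseChange_tmul, LinearMap.add_apply, one_smul,
          LinearMap.comp_apply, LinearMap.coe_restrictScalars]
        rw [← map_add]
        rfl
    refine ⟨AddMonoidHom.toIntLinearMap (AddMonoidHom.mk' (fun f => (c f).uncurryLeft)
      fun f g => ?_), fun f h => ?_⟩
    · rw [map_add]
      rfl
    · have h1 := hE (f.curryLeft (h 0)) (Fin.tail h)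
      rw [MultilinearMap.curryLeft_apply, Fin.cons_self_tail] at h1
      rw [← h1]
      simp [c, LinearMap.uncurryLeft_apply, Fin.tail_def]

end Extension

attribute [local instance] MvPolynomial.gradedAlgebra

/-! ### Hyperplanes avoiding finitely many points -/

section ProjectiveSpace

variable {K : Type u} [Field K]

theorem exists_X_notMem {N : ℕ} (p : projectiveSpace K N) :
    ∃ i : Fin (N + 1), p ∈ Proj.basicOpen (MvPolynomial.homogeneousSubmodule (Fin (N + 1)) K)
      (MvPolynomial.X i) := by
  by_contra! h
  refine p.not_irrelevant_le fun f hf => ?_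
  have hle : Ideal.span (MvPolynomial.X '' (Set.univ : Set (Fin (N + 1)))) ≤
      p.asHomogeneousIdeal.toIdeal := by
    rw [Ideal.span_le]
    rintro _ ⟨i, -, rfl⟩
    by_contra hi
    exact h i ((Proj.mem_basicOpen _ _ _).2 hi)
  refine hle (MvPolynomial.mem_ideal_span_X_image.2 fun m hm => ?_)
  -- A monomial divisible by no variable is constant, and elements of the irrelevant ideal have no
  -- constant term.
  by_contra! h0
  have hm0 : m = 0 := Finsupp.ext fun i => h0 i (Set.mem_univ i)
  have hf0 := (HomogeneousIdeal.mem_irrelevant_iff _ _).1 hf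
  rw [GradedRing.proj_apply] at hf0
  replace hf0 : MvPolynomial.homogeneousComponent 0 f = 0 :=
    (MvPolynomial.decomposition.decompose'_apply f 0).symm.trans hf0
  rw [MvPolynomial.homogeneousComponent_zero] at hf0
  rw [MvPolynomial.mem_support_iff, hm0] at hm
  exact hm (by simpa using hf0)

/-- The linear form with given coefficients. -/
def linearForm (K : Type u) [Field K] (N : ℕ) :
    (Fin (N + 1) → K) →ₗ[K] MvPolynomial (Fin (N + 1)) K :=
  Fintype.linearCombination K MvPolynomial.X

theorem linearForm_mem (N : ℕ) (c : Fin (N + 1) → K) :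
    linearForm K N c ∈ MvPolynomial.homogeneousSubmodule (Fin (N + 1)) K 1 := by
  rw [linearForm, Fintype.linearCombination_apply]
  exact Submodule.sum_mem _ fun i _ => Submodule.smul_mem _ _ (MvPolynomial.isHomogeneous_X K i)

/-- The linear forms vanishing at a given point form a proper subspace, and a vector space over an
infinite field is not a finite union of proper subspaces. -/
theorem exists_linearForm_notMem [Infinite K] {N : ℕ} (S : Finset (projectiveSpace K N)) :
    ∃ c, ∀ p ∈ S, p ∈ Proj.basicOpen (MvPolynomial.homogeneousSubmodule (Fin (N + 1)) K)
      (linearForm K N c) := by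
  classical
  let W (p : projectiveSpace K N) : Subspace K (Fin (N + 1) → K) :=
    (p.asHomogeneousIdeal.toIdeal.restrictScalars K).comap (linearForm K N)
  have hW : ⊤ ∉ S.image W := by
    rw [Finset.mem_image]
    rintro ⟨p, -, hp⟩
    obtain ⟨i, hi⟩ := exists_X_notMem p
    have h : Pi.single i 1 ∈ W p := hp ▸ Submodule.mem_top
    refine (Proj.mem_basicOpen _ _ _).1 hi ?_
    simpa [W, linearForm, Fintype.linearCombination_apply_single] using h
  have := Subspace.biUnion_ne_univ_of_top_notMem hW
  rw [Set.ne_univ_iff_exists_notMem] at this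
  obtain ⟨c, hc⟩ := this
  refine ⟨c, fun p hp => (Proj.mem_basicOpen _ _ _).2 fun hm => hc ?_⟩
  exact Set.mem_biUnion (Finset.mem_image_of_mem W hp) hm

end ProjectiveSpace

/-! ### Affine neighbourhoods of finite sets and finiteness of the curve -/

section Curve

variable {K : Type u} [Field K] (X : SmoothProjectiveCurve K)

theorem exists_isAffineOpen_of_finset [Infinite K] (S : Finset X.toScheme) :
    ∃ U : X.toScheme.Opens, IsAffineOpen U ∧ ∀ x ∈ S, x ∈ U := by
  classical
  obtain ⟨N, i, hi, -⟩ := X.projective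
  obtain ⟨c, hc⟩ := exists_linearForm_notMem (S.image i)
  refine ⟨i ⁻¹ᵁ Proj.basicOpen _ (linearForm K N c), ?_, fun x hx => ?_⟩
  · exact (Proj.isAffineOpen_basicOpen _ _ (linearForm_mem N c) one_pos).preimage i
  · exact hc _ (Finset.mem_image_of_mem i hx)

theorem compactSpace_toScheme : CompactSpace X.toScheme := by
  obtain ⟨N, i, hi, -⟩ := X.projective
  let U (j : Fin (N + 1)) : X.toScheme.Opens := i ⁻¹ᵁ Proj.basicOpen _ (MvPolynomial.X j)
  have hU : (Set.univ : Set X.toScheme) = ⋃ j, (U j : Set X.toScheme) := by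
    refine (Set.eq_univ_of_forall fun x => ?_).symm
    obtain ⟨j, hj⟩ := exists_X_notMem (i x)
    exact Set.mem_iUnion.2 ⟨j, hj⟩
  refine ⟨hU ▸ isCompact_iUnion fun j => IsAffineOpen.isCompact ?_⟩
  exact (Proj.isAffineOpen_basicOpen _ _ (MvPolynomial.isHomogeneous_X K j) one_pos).preimage i

theorem noetherianSpace_toScheme : TopologicalSpace.NoetherianSpace X.toScheme := by
  have := compactSpace_toScheme X
  have : AlgebraicGeometry.IsNoetherian X.toScheme := {}
  infer_instance

end Curve

/-! ### Orders of vanishing on integral locally Noetherian schemes -/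

section Scheme

variable {X : Scheme.{u}}

theorem specializes_of_coheight_eq_one {x y : X} (hx : Order.coheight x = 1)
    (hy : Order.coheight y = 1) (h : x ⤳ y) : x = y := by
  by_contra hxy
  have hn : ¬ x ≤ y := fun hn => hxy (h.antisymm (Scheme.le_iff_specializes.1 hn)).eq
  rw [← Scheme.le_iff_specializes] at h
  have := Order.coheight_add_one_le (lt_of_le_not_ge h hn)
  rw [hx, hy] at this
  exact absurd this (by decide)

theorem coheight_genericPoint [IsIntegral X] : Order.coheight (genericPoint X) = 0 := by
  rw [Order.coheight_eq_zero]
  intro b _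
  rw [Scheme.le_iff_specializes]
  exact (genericPoint_spec X).specializes trivial

variable [IsIntegral X] [IsLocallyNoetherian X]

theorem ord_eq_zero_of_mem_basicOpen {U : X.Opens} [Nonempty U] {a : Γ(X, U)} {x : X}
    (hx : x ∈ X.basicOpen a) : Scheme.ord (X.germToFunctionField U a) x = 0 := by
  by_cases h1 : Order.coheight x = 1
  · have hxU := X.basicOpen_le a hx
    have hu := (X.mem_basicOpen a x hxU).1 hx
    have : Ring.KrullDimLE 1 (X.presheaf.stalk x) := krullDimLE_of_coheight_le h1.le
    rw [Scheme.ord_eq_ordHom_of_coheight_eq_one h1,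
      ← Scheme.algebraMap_germ_eq_germToFunctionField X hxU]
    have : X.ordHom x h1 (algebraMap (X.presheaf.stalk x) X.functionField
        (X.presheaf.germ U x hxU a)) = 1 := Ring.ordFrac_of_isUnit hu
    rw [this]
    rfl
  · exact Scheme.ord_eq_zero_of_coheight_neq_one h1 _

/-- The order of a nonzero germ is the length of the stalk modulo that germ, which is zero only for
a unit. -/
theorem ord_ne_zero_of_notMem_basicOpen {U : X.Opens} [Nonempty U] {a : Γ(X, U)} (ha : a ≠ 0)
    {x : X} (hxU : x ∈ U) (h1 : Order.coheight x = 1) (hx : x ∉ X.basicOpen a) :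
    Scheme.ord (X.germToFunctionField U a) x ≠ 0 := by
  have hu := mt (X.mem_basicOpen a x hxU).2 hx
  have : Ring.KrullDimLE 1 (X.presheaf.stalk x) := krullDimLE_of_coheight_le h1.le
  set b := X.presheaf.germ U x hxU a with hb
  have hb0 : b ≠ 0 := by
    rw [hb, map_ne_zero_iff _ (germ_injective_of_isIntegral X x hxU)]
    exact ha
  have ha0 : X.germToFunctionField U a ≠ 0 :=
    (map_ne_zero_iff _ (X.germToFunctionField_injective U)).2 ha
  intro h0
  rw [Scheme.ord_eq_iff h1 ha0, ← Scheme.algebraMap_germ_eq_germToFunctionField X hxU] at h0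
  have hord : Ring.ordFrac (X.presheaf.stalk x) (algebraMap (X.presheaf.stalk x)
      X.functionField b) = Multiplicative.ofAdd (0 : ℤ) := h0
  have hbn : b ∈ nonZeroDivisors (X.presheaf.stalk x) := mem_nonZeroDivisors_of_ne_zero hb0
  obtain ⟨m, hm⟩ := ENat.ne_top_iff_exists.1 (Ring.ord_ne_top hbn)
  rw [Ring.ordFrac_eq_ord _ hb0, Ring.ordMonoidWithZeroHom_eq_coe _ hbn hm.symm] at hord
  have hm0 : m = 0 := by
    have := Multiplicative.ofAdd.injective (WithZero.coe_injective hord)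
    exact_mod_cast this
  rw [hm0, Ring.ord] at hm
  have := Module.length_eq_zero_iff.1 hm.symm
  rw [Ideal.Quotient.subsingleton_iff, Ideal.span_singleton_eq_top] at this
  exact hu this

/-- Represent `f` by a section `s`. A codimension one point outside `X.basicOpen s` is the generic
point of one of the finitely many irreducible closed sets making up the complement: otherwise that
generic point would have coheight zero and be the generic point of `X`, where `s` is invertible. -/
theorem finite_support_ord [TopologicalSpace.NoetherianSpace X] {f : X.functionField}
    (hf : f ≠ 0) : (Function.support (Scheme.ord f)).Finite := by
  obtain ⟨U, hU, s, rfl⟩ := TopCat.Presheaf.exists_germ_eq X.presheaf f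
  have : Nonempty U := ⟨⟨_, hU⟩⟩
  have hs : genericPoint X ∈ X.basicOpen s :=
    (X.mem_basicOpen s _ hU).2 (isUnit_iff_ne_zero.2 hf)
  obtain ⟨S, hS, hcl, hirr, hZ⟩ :=
    TopologicalSpace.NoetherianSpace.exists_finite_set_isClosed_irreducible
      (X.basicOpen s).isOpen.isClosed_compl
  have hgen (t : Set X) (ht : t ∈ S) : ∃ z, IsGenericPoint z t :=
    QuasiSober.sober (hirr t ht) (hcl t ht)
  choose! g hg using hgen
  refine (hS.image g).subset fun z hz => ?_
  have h1 : Order.coheight z = 1 := by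
    by_contra h1
    exact hz (Scheme.ord_eq_zero_of_coheight_neq_one h1 _)
  have hzs : z ∈ ⋃₀ S := by
    rw [← hZ]
    exact fun hzs => hz (ord_eq_zero_of_mem_basicOpen hzs)
  obtain ⟨t, ht, hzt⟩ := hzs
  refine ⟨t, ht, ?_⟩
  have hspec := (hg t ht).specializes hzt
  by_contra hne
  have hlt : z < g t := by
    refine lt_of_le_not_ge (Scheme.le_iff_specializes.2 hspec) fun hle => hne ?_
    exact (hspec.antisymm (Scheme.le_iff_specializes.1 hle)).eq
  have h0 := Order.coheight_add_one_le hlt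
  rw [h1] at h0
  have h0' : Order.coheight (g t) = 0 := by
    have : Order.coheight (g t) + 1 ≤ 0 + 1 := by simpa using h0
    exact nonpos_iff_eq_zero.1 ((ENat.add_le_add_iff_right (by simp)).1 this)
  have hmax := Order.coheight_eq_zero.1 h0'
  have hgs : genericPoint X ⤳ g t := (genericPoint_spec X).specializes trivial
  have hsg := Scheme.le_iff_specializes.1 (hmax (Scheme.le_iff_specializes.2 hgs))
  have hmem : g t ∈ ⋃₀ S := ⟨t, ht, (hg t ht).mem⟩
  rw [← hZ, ← (hgs.antisymm hsg).eq] at hmem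
  exact hmem hs

/-- Prime avoidance on the affine open: the prime of `x` is contained in no prime of another point
of `S`, since codimension one points do not specialize to one another. -/
theorem exists_ord_ne_zero {U : X.Opens} (hU : IsAffineOpen U) {S : Finset X}
    (hSU : ∀ y ∈ S, y ∈ U) (hS : ∀ y ∈ S, Order.coheight y = 1) {x : X} (hx : x ∈ S) :
    ∃ f : X.functionField, f ≠ 0 ∧ Scheme.ord f x ≠ 0 ∧
      ∀ y ∈ S, y ≠ x → Scheme.ord f y = 0 := by
  classical
  have : Nonempty U := ⟨⟨x, hSU x hx⟩⟩
  have hgU : genericPoint X ∈ U :=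
    ((genericPoint_spec X).mem_open_set_iff U.isOpen).2 (by simpa using ⟨x, hSU x hx⟩)
  -- Avoiding the generic point as well forces the section found below to be nonzero.
  let T : Finset U := (insert (genericPoint X) (S.erase x)).subtype (· ∈ U)
  let I (y : U) : Ideal Γ(X, U) :=
    (IsLocalRing.maximalIdeal (X.presheaf.stalk y.1)).comap (X.presheaf.germ U y.1 y.2).hom
  have hI (y : U) (a : Γ(X, U)) : a ∈ I y ↔ y.1 ∉ X.basicOpen a := by
    rw [X.mem_basicOpen a y.1 y.2]
    exact Iff.rfl
  have hT (y : U) (hy : y ∈ T) : ¬ x ⤳ y.1 := by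
    intro h
    rcases Finset.mem_insert.1 (Finset.mem_subtype.1 hy) with hy | hy
    · rw [hy] at h
      have := (h.antisymm ((genericPoint_spec X).specializes trivial)).eq
      have h1 := hS x hx
      rw [this, coheight_genericPoint] at h1
      exact zero_ne_one h1
    · have hz := Finset.mem_erase.1 hy
      exact hz.1 (specializes_of_coheight_eq_one (hS _ hx) (hS _ hz.2) h).symm
  have havoid : ¬ ((I ⟨x, hSU x hx⟩ : Set Γ(X, U)) ⊆ ⋃ y ∈ (T : Set U), (I y : Set Γ(X, U))) := by
    -- The two indices are those exempted from primality; any choice works because every `I y` is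
    -- prime.
    rw [Ideal.subset_union_prime ⟨x, hSU x hx⟩ ⟨x, hSU x hx⟩ fun y _ _ _ => inferInstance]
    rintro ⟨y, hy, hle⟩
    refine hT y hy (specializes_iff_forall_open.2 fun V hV hyV => ?_)
    obtain ⟨a, haV, hya⟩ := hU.exists_basicOpen_le (V := ⟨V, hV⟩) ⟨y.1, hyV⟩ y.2
    by_contra hxV
    exact (hI y a).1 (hle ((hI ⟨x, hSU x hx⟩ a).2 fun hxa => hxV (haV hxa))) hya
  obtain ⟨a, hax, ha⟩ := Set.not_subset.1 havoid
  have ha' (y : U) (hy : y ∈ T) : y.1 ∈ X.basicOpen a := by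
    by_contra h
    exact ha (Set.mem_biUnion hy ((hI y a).2 h))
  have ha0 : a ≠ 0 := by
    rintro rfl
    simpa using ha' ⟨_, hgU⟩ (Finset.mem_subtype.2 (Finset.mem_insert_self _ _))
  refine ⟨X.germToFunctionField U a, (map_ne_zero_iff _ (X.germToFunctionField_injective U)).2 ha0,
    ord_ne_zero_of_notMem_basicOpen ha0 (hSU x hx) (hS x hx) ((hI _ a).1 hax), fun y hy hyx => ?_⟩
  refine ord_eq_zero_of_mem_basicOpen (ha' ⟨y, hSU y hy⟩ ?_)
  exact Finset.mem_subtype.2 (Finset.mem_insert_of_mem (Finset.mem_erase.2 ⟨hyx, hy⟩))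

end Scheme

/-! ### Separating families -/

section Separating

variable {K : Type u} [Field K] {X : SmoothProjectiveCurve K}

theorem finite_divSupport (f : RatFun X) : (divSupport f).Finite := by
  have := noetherianSpace_toScheme X
  exact finite_support_ord f.ne_zero

theorem coheight_of_mem_divSupport {f : RatFun X} {x : X.toScheme} (hx : x ∈ divSupport f) :
    Order.coheight x = 1 := by
  by_contra h1
  exact hx (Scheme.ord_eq_zero_of_coheight_neq_one h1 _)

theorem exists_ordLin_ne_zero [Infinite K] {S : Finset X.toScheme}
    (hS : ∀ y ∈ S, Order.coheight y = 1) {x : X.toScheme} (hx : x ∈ S) :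
    ∃ f : Additive (RatFun X), ordLin X x f ≠ 0 ∧ ∀ y ∈ S, y ≠ x → ordLin X y f = 0 := by
  obtain ⟨U, hU, hSU⟩ := exists_isAffineOpen_of_finset X S
  obtain ⟨f, hf, h⟩ := exists_ord_ne_zero hU hSU hS hx
  exact ⟨Additive.ofMul (Units.mk0 f hf), h⟩

/-- Functions of non-zero order at prescribed points of a finite set `S`, which vanish at no other
point of `S` and whose divisors have no common point outside `S`. -/
theorem exists_separating_aux [Infinite K] {S : Finset X.toScheme}
    (hS : ∀ y ∈ S, Order.coheight y = 1) {ι : Type*} (π : ι → X.toScheme) (hπ : ∀ j, π j ∈ S)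
    (J : Finset ι) :
    ∃ t : ι → Additive (RatFun X), ∀ j ∈ J, ordLin X (π j) (t j) ≠ 0 ∧
      (∀ y ∈ S, y ≠ π j → ordLin X y (t j) = 0) ∧
      ∀ k ∈ J, k ≠ j → ∀ y ∉ S, ordLin X y (t j) = 0 ∨ ordLin X y (t k) = 0 := by
  classical
  induction J using Finset.induction_on with
  | empty => exact ⟨0, by simp⟩
  | insert a J ha ih =>
    obtain ⟨t, ht⟩ := ih
    let D : Finset X.toScheme := J.biUnion fun j => (finite_divSupport (t j).toMul).toFinset
    have hD (j) (hj : j ∈ J) (y) (hy : y ∉ D) : ordLin X y (t j) = 0 := by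
      by_contra h
      exact hy (Finset.mem_biUnion.2 ⟨j, hj, (Set.Finite.mem_toFinset _).2 h⟩)
    -- Enlarging `S` by the earlier divisors `D` keeps the divisor of the new function away from
    -- them outside `S`.
    obtain ⟨f, hf, hf'⟩ := exists_ordLin_ne_zero (S := S ∪ D) (x := π a) (fun y hy => by
      rcases Finset.mem_union.1 hy with hy | hy
      · exact hS y hy
      · obtain ⟨j, -, hj⟩ := Finset.mem_biUnion.1 hy
        exact coheight_of_mem_divSupport ((Set.Finite.mem_toFinset _).1 hj))
      (Finset.mem_union_left _ (hπ a))
    have key (j) (hj : j ∈ J) (y) (hy : y ∉ S) : ordLin X y f = 0 ∨ ordLin X y (t j) = 0 := by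
      by_cases hyD : y ∈ D
      · exact .inl (hf' y (Finset.mem_union_right _ hyD) fun h => hy (h ▸ hπ a))
      · exact .inr (hD j hj y hyD)
    have hne (j) (hj : j ∈ J) : j ≠ a := fun h => ha (h ▸ hj)
    refine ⟨Function.update t a f, fun j hj => ?_⟩
    rcases Finset.mem_insert.1 hj with hja | hj
    · subst hja
      simp only [Function.update_self]
      refine ⟨hf, fun y hy => hf' y (Finset.mem_union_left _ hy), fun k hk hkj y hy => ?_⟩
      rw [Function.update_of_ne hkj]
      exact key k (Finset.mem_of_mem_insert_of_ne hk hkj) y hy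
    · rw [Function.update_of_ne (hne j hj)]
      refine ⟨(ht j hj).1, (ht j hj).2.1, fun k hk hkj y hy => ?_⟩
      rcases Finset.mem_insert.1 hk with hka | hk
      · rw [hka, Function.update_self]
        exact (key j hj y hy).symm
      · rw [Function.update_of_ne (hne k hk)]
        exact (ht j hj).2.2 k hk hkj y hy

/-- A family of functions `t i x`, for `i : Fin n` and `x` in the finite set `S`, of common order
`M ≠ 0` at `x`, without zeros or poles at other points of `S`, and whose divisors have no common
point outside `S`. -/
structure SeparatingFamily (X : SmoothProjectiveCurve K) (n : ℕ) (S : Finset X.toScheme) where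
  t : Fin n → S → Additive (RatFun X)
  M : ℤ
  M_ne_zero : M ≠ 0
  ord_self : ∀ i x, ordLin X x.1 (t i x) = M
  ord_of_ne : ∀ i x, ∀ y ∈ S, y ≠ x.1 → ordLin X y (t i x) = 0
  ord_eq_zero_or : ∀ i x j x', (j, x') ≠ (i, x) → ∀ y ∉ S,
    ordLin X y (t i x) = 0 ∨ ordLin X y (t j x') = 0

theorem nonempty_separatingFamily [Infinite K] (n : ℕ) {S : Finset X.toScheme}
    (hS : ∀ y ∈ S, Order.coheight y = 1) : Nonempty (SeparatingFamily X n S) := by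
  classical
  obtain ⟨t, ht⟩ := exists_separating_aux hS (fun j : Fin n × S => j.2.1) (fun j => j.2.2)
    Finset.univ
  simp only [Finset.mem_univ, true_implies] at ht
  let m (j : Fin n × S) : ℤ := ordLin X j.2.1 (t j)
  exact ⟨{
    -- Multiplying by the orders of all the other functions makes every order equal to the full
    -- product.
    t := fun i x => (∏ k ∈ Finset.univ.erase (i, x), m k) • t (i, x)
    M := ∏ k, m k
    M_ne_zero := Finset.prod_ne_zero_iff.2 fun k _ => (ht k).1
    ord_self := fun i x => by
      rw [map_smul, smul_eq_mul]
      exact Finset.prod_erase_mul _ _ (Finset.mem_univ (i, x))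
    ord_of_ne := fun i x y hy hyx => by rw [map_smul, (ht (i, x)).2.1 y hy hyx, smul_zero]
    ord_eq_zero_or := fun i x j x' hne y hy => by
      rw [map_smul, map_smul]
      exact ((ht (i, x)).2.2 (j, x') hne y hy).imp (by simp +contextual) (by simp +contextual) }⟩

/-! ### Decomposition into components and the extended symbol -/

namespace SeparatingFamily

variable {n : ℕ} {S : Finset X.toScheme} (T : SeparatingFamily X n S)

/-- The components of a function with respect to a separating family. -/
def component (i : Fin n) : Option S → Additive (RatFun X) →ₗ[ℤ] Additive (RatFun X)
  | some x => (ordLin X x.1).smulRight (T.t i x)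
  | none => T.M • LinearMap.id - ∑ x : S, (ordLin X x.1).smulRight (T.t i x)

theorem component_some (i : Fin n) (x : S) (f : Additive (RatFun X)) :
    T.component i (some x) f = ordLin X x.1 f • T.t i x := rfl

theorem component_none (i : Fin n) (f : Additive (RatFun X)) :
    T.component i none f = T.M • f - ∑ x : S, ordLin X x.1 f • T.t i x := by
  simp [component]

theorem sum_component (i : Fin n) (f : Additive (RatFun X)) :
    ∑ o, T.component i o f = T.M • f := by
  simp [Fintype.sum_option, component_none, component_some]

/-- Assignments that use every point of `S` at most once. -/
def IsGood (o : Fin n → Option S) : Prop := ∀ i j, i ≠ j → o i = o j → o i = none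

/-- The points at which the component with index `o` can have a zero or a pole. -/
def componentSupport (i : Fin n) : Option S → Set X.toScheme
  | some x => {y | ordLin X y (T.t i x) ≠ 0}
  | none => {y | y ∉ S ∧ ∃ x, ordLin X y (T.t i x) ≠ 0}

/-- For the remainder, at a point `y ∈ S` only `t i y` contributes to the sum, and its order `M`
cancels that of `M • f`. -/
theorem component_mem (i : Fin n) (o : Option S) {f : Additive (RatFun X)}
    (hf : f ∈ supportedIn X (S : Set X.toScheme)) :
    T.component i o f ∈ supportedIn X (T.componentSupport i o) := by
  classical
  rw [mem_supportedIn] at hf ⊢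
  intro y hy
  cases o with
  | some x =>
    have : ordLin X y (T.t i x) = 0 := not_not.1 hy
    rw [component_some, map_smul, this, smul_zero]
  | none =>
    rw [component_none, map_sub, map_sum]
    by_cases hyS : y ∈ S
    · rw [Finset.sum_eq_single (⟨y, hyS⟩ : S)]
      · have := T.ord_self i ⟨y, hyS⟩
        simp only at this
        rw [map_smul, map_smul, this, smul_eq_mul, smul_eq_mul, mul_comm, sub_self]
      · intro x _ hx
        rw [map_smul, T.ord_of_ne i x y hyS fun h => hx (Subtype.ext h.symm), smul_zero]
      · exact fun h => absurd (Finset.mem_univ _) h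
    · rw [map_smul, hf y hyS, smul_zero, zero_sub, neg_eq_zero]
      refine Finset.sum_eq_zero fun x _ => ?_
      have : ordLin X y (T.t i x) = 0 := by
        by_contra h
        exact hy ⟨hyS, x, h⟩
      rw [map_smul, this, smul_zero]

theorem exists_of_mem_componentSupport {i : Fin n} {o : Option S} {y : X.toScheme}
    (hy : y ∈ T.componentSupport i o) :
    (∃ hyS : y ∈ S, o = some ⟨y, hyS⟩) ∨ y ∉ S ∧ ∃ x, ordLin X y (T.t i x) ≠ 0 := by
  cases o with
  | some x =>
    by_cases hyS : y ∈ S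
    · refine .inl ⟨hyS, ?_⟩
      by_contra h
      exact hy (T.ord_of_ne i x y hyS fun e => h (by simp [e]))
    · exact .inr ⟨hyS, x, hy⟩
  | none => exact .inr hy

theorem disjoint_componentSupport {o : Fin n → Option S} (ho : IsGood o) (i j : Fin n)
    (hij : i ≠ j) :
    Disjoint (T.componentSupport i (o i)) (T.componentSupport j (o j)) := by
  rw [Set.disjoint_left]
  intro y hi hj
  rcases T.exists_of_mem_componentSupport hi with ⟨hyS, hi⟩ | ⟨hyS, x, hx⟩ <;>
  rcases T.exists_of_mem_componentSupport hj with ⟨hyS', hj⟩ | ⟨hyS', x', hx'⟩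
  · have := ho i j hij (hi.trans hj.symm)
    rw [hi] at this
    cases this
  · exact hyS' hyS
  · exact hyS hyS'
  · have hne : (j, x') ≠ (i, x) := fun h => hij (congrArg Prod.fst h).symm
    exact (T.ord_eq_zero_or i x j x' hne y hyS).elim hx hx'

/-- The multilinear map sending a tuple to the symbol of its components with indices `o`. -/
def componentSymbol {o : Fin n → Option S} (ho : IsGood o) :
    MultilinearMap ℤ (fun _ : Fin n => supportedIn X (S : Set X.toScheme)) (V X n) :=
  (symbolMultilinear (T.disjoint_componentSupport ho)).compLinearMap fun i =>
    ((T.component i (o i)).comp (Submodule.subtype _)).codRestrict _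
      fun f => T.component_mem i (o i) f.2

theorem componentSymbol_eq_symbol {o : Fin n → Option S} (ho : IsGood o)
    (f : Fin n → supportedIn X (S : Set X.toScheme)) (d : DisjointTuple X n)
    (h : ∀ i, T.component i (o i) (f i) = Additive.ofMul (d.fn i)) :
    T.componentSymbol ho f = symbol d :=
  symbolMultilinear_eq_symbol _ _ d h

theorem theta_componentSymbol {o : Fin n → Option S} (ho : IsGood o)
    (f : Fin n → supportedIn X (S : Set X.toScheme)) :
    theta X n (T.componentSymbol ho f) =
      wedge X n fun i => (T.component i (o i) (f i)).toMul := by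
  exact theta_symbol _

open scoped Classical in
/-- The multilinear extension of the symbol to all functions with divisor supported in `S`, up to a
factor. -/
def extendedSymbol :
    MultilinearMap ℤ (fun _ : Fin n => supportedIn X (S : Set X.toScheme)) (V X n) :=
  ∑ o : Fin n → Option S, if ho : IsGood o then T.componentSymbol ho else 0

/-- A set containing the supports of all components of `f`. -/
def hull (i : Fin n) (f : Additive (RatFun X)) : Set X.toScheme :=
  {y | y ∈ S ∧ ordLin X y f ≠ 0 ∨ y ∉ S ∧ ∃ x : S, ordLin X x.1 f ≠ 0 ∧ ordLin X y (T.t i x) ≠ 0}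

/-- The component at `x` vanishes when `f` has order zero at `x`. The hull bounds all components of
`f` at once, so one multilinear symbol map applies to every term of the expansion of a disjoint
tuple. -/
theorem component_mem_hull (i : Fin n) (o : Option S) {f : Additive (RatFun X)}
    (hf : f ∈ supportedIn X (S : Set X.toScheme)) :
    T.component i o f ∈ supportedIn X (T.hull i f) := by
  have hc := mem_supportedIn.1 (T.component_mem i o hf)
  rw [mem_supportedIn] at hf ⊢
  intro y hy
  have hyt (hyS : y ∉ S) (x : S) (hx : ordLin X x.1 f ≠ 0) : ordLin X y (T.t i x) = 0 := by
    by_contra h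
    exact hy (.inr ⟨hyS, x, hx, h⟩)
  by_cases hyS : y ∈ S
  · cases o with
    | some x =>
      by_cases hyx : y = x.1
      · have : ordLin X x.1 f = 0 := by
          by_contra h
          exact hy (.inl ⟨hyS, hyx ▸ h⟩)
        rw [component_some, this, zero_smul, map_zero]
      · rw [component_some, map_smul, T.ord_of_ne i x y hyS hyx, smul_zero]
    | none => exact hc y fun h => h.1 hyS
  · have hz (x : S) : ordLin X x.1 f • ordLin X y (T.t i x) = 0 := by
      by_cases hx : ordLin X x.1 f = 0
      · rw [hx, zero_smul]
      · rw [hyt hyS x hx, smul_zero]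
    cases o with
    | some x => rw [component_some, map_smul, hz]
    | none => simp only [component_none, map_sub, map_sum, map_smul, hz, hf y hyS, smul_zero,
        Finset.sum_const_zero, sub_zero]

theorem mem_supportedIn_hull (i : Fin n) {f : Additive (RatFun X)}
    (hf : f ∈ supportedIn X (S : Set X.toScheme)) : f ∈ supportedIn X (T.hull i f) := by
  rw [mem_supportedIn] at hf ⊢
  intro y hy
  by_cases hyS : y ∈ S
  · by_contra h
    exact hy (.inl ⟨hyS, h⟩)
  · exact hf y hyS

theorem ordLin_eq_zero_or (f : DisjointTuple X n) {i j : Fin n} (hij : i ≠ j) (y : X.toScheme) :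
    ordLin X y (Additive.ofMul (f.fn i)) = 0 ∨ ordLin X y (Additive.ofMul (f.fn j)) = 0 := by
  by_contra! h
  exact Set.disjoint_left.1 (f.disjoint i j hij) h.1 h.2

theorem disjoint_hull (f : DisjointTuple X n) (i j : Fin n) (hij : i ≠ j) :
    Disjoint (T.hull i (Additive.ofMul (f.fn i))) (T.hull j (Additive.ofMul (f.fn j))) := by
  rw [Set.disjoint_left]
  rintro y (⟨hyS, hi⟩ | ⟨hyS, x, -, hx⟩) (⟨hyS', hj⟩ | ⟨hyS', x', -, hx'⟩)
  · exact (ordLin_eq_zero_or f hij y).elim hi hj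
  · exact hyS' hyS
  · exact hyS hyS'
  · have hne : (j, x') ≠ (i, x) := fun h => hij (congrArg Prod.fst h).symm
    exact (T.ord_eq_zero_or i x j x' hne y hyS).elim hx hx'

theorem exists_of_not_isGood {o : Fin n → Option S} (ho : ¬ IsGood o) :
    ∃ i j x, i ≠ j ∧ o i = some x ∧ o j = some x := by
  simp only [IsGood, not_forall] at ho
  obtain ⟨i, j, hij, h, h0⟩ := ho
  obtain ⟨x, hx⟩ := Option.ne_none_iff_exists'.1 h0
  exact ⟨i, j, x, hij, hx, h ▸ hx⟩

/-- Expanding the symbol of the functions `M • f i` inside the disjoint hulls gives all assignments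
`o`. The bad ones contribute zero: two functions with disjoint divisors cannot both have nonzero
order at the repeated point. -/
theorem extendedSymbol_apply (f : DisjointTuple X n)
    (hf : ∀ i, Additive.ofMul (f.fn i) ∈ supportedIn X (S : Set X.toScheme)) :
    T.extendedSymbol (fun i => ⟨_, hf i⟩) = ((T.M ^ n : ℤ) : ℚ) • symbol f := by
  classical
  let B := symbolMultilinear (T.disjoint_hull f)
  let g (i : Fin n) (o : Option S) : supportedIn X (T.hull i (Additive.ofMul (f.fn i))) :=
    ⟨T.component i o (Additive.ofMul (f.fn i)), T.component_mem_hull i o (hf i)⟩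
  have hg (i : Fin n) : ∑ o, g i o = T.M • ⟨_, T.mem_supportedIn_hull i (hf i)⟩ := by
    ext1
    simp only [g, AddSubmonoidClass.coe_finsetSum, SetLike.val_smul]
    exact T.sum_component i _
  have hB : ∑ o : Fin n → Option S, B (fun i => g i (o i)) = ((T.M ^ n : ℤ) : ℚ) • symbol f := by
    rw [← MultilinearMap.map_sum]
    simp only [hg]
    rw [MultilinearMap.map_smul_univ, Finset.prod_const, Finset.card_univ, Fintype.card_fin,
      Int.cast_smul_eq_zsmul, symbolMultilinear_eq_symbol (T.disjoint_hull f) _ f fun _ => rfl]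
  rw [← hB, extendedSymbol, sum_apply]
  refine Finset.sum_congr rfl fun o _ => ?_
  split_ifs with ho
  · rw [symbolMultilinear_apply]
    exact T.componentSymbol_eq_symbol ho _ _ fun _ => rfl
  · obtain ⟨i, j, x, hij, hi, hj⟩ := exists_of_not_isGood ho
    rw [zero_apply]
    rcases ordLin_eq_zero_or f hij x.1 with h | h
    · refine (B.map_coord_zero i (Subtype.ext ?_)).symm
      simp only [g, hi, component_some, h, zero_smul, Submodule.coe_zero]
    · refine (B.map_coord_zero j (Subtype.ext ?_)).symm
      simp only [g, hj, component_some, h, zero_smul, Submodule.coe_zero]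

/-- After antisymmetrization, the terms in which a point is used twice cancel. -/
theorem sum_perm_eq_zero {W : Type*} [AddCommGroup W] [Module ℚ W]
    (w : MultilinearMap ℤ (fun _ : Fin n => Additive (RatFun X)) W)
    (f : Fin n → Additive (RatFun X)) {o : Fin n → Option S} (ho : ¬ IsGood o) :
    ∑ σ : Equiv.Perm (Fin n), (Equiv.Perm.sign σ : ℤ) •
      w (fun k => T.component k (o k) (f (σ k))) = 0 := by
  classical
  obtain ⟨i, j, x, hij, hi, hj⟩ := exists_of_not_isGood ho
  -- In the slots `i` and `j`, both labelled `x`, the permutation enters only through the scalars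
  -- `a`, while `v` holds functions independent of it there. Composing with the swap preserves the
  -- product of the scalars and reverses the sign.
  let a (σ : Equiv.Perm (Fin n)) (k : Fin n) : ℤ :=
    if k = i ∨ k = j then ordLin X x.1 (f (σ k)) else 1
  let v (σ : Equiv.Perm (Fin n)) (k : Fin n) : Additive (RatFun X) :=
    if k = i ∨ k = j then T.t k x else T.component k (o k) (f (σ k))
  have hav (σ : Equiv.Perm (Fin n)) :
      (fun k => T.component k (o k) (f (σ k))) = fun k => a σ k • v σ k := by
    funext k
    by_cases hk : k = i ∨ k = j
    · have hok : o k = some x := by rcases hk with rfl | rfl <;> assumption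
      simp [a, v, hk, hok, component_some]
    · simp [a, v, hk]
  have hswap (k : Fin n) : (Equiv.swap i j k = i ∨ Equiv.swap i j k = j) ↔ (k = i ∨ k = j) := by
    rw [Equiv.swap_apply_eq_iff, Equiv.swap_apply_eq_iff, Equiv.swap_apply_left,
      Equiv.swap_apply_right, or_comm]
  have hv (σ : Equiv.Perm (Fin n)) : v (σ * Equiv.swap i j) = v σ := by
    funext k
    by_cases hk : k = i ∨ k = j
    · simp [v, hk]
    · have h := not_or.1 hk
      simp [v, hk, Equiv.swap_apply_of_ne_of_ne h.1 h.2]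
  have ha (σ : Equiv.Perm (Fin n)) : ∏ k, a (σ * Equiv.swap i j) k = ∏ k, a σ k := by
    rw [← Equiv.prod_comp (Equiv.swap i j) (a σ)]
    refine Finset.prod_congr rfl fun k _ => ?_
    simp [a, hswap]
  have hterm (σ : Equiv.Perm (Fin n)) :
      (Equiv.Perm.sign (σ * Equiv.swap i j) : ℤ) •
          w (fun k => T.component k (o k) (f ((σ * Equiv.swap i j) k))) =
        -((Equiv.Perm.sign σ : ℤ) • w (fun k => T.component k (o k) (f (σ k)))) := by
    rw [hav, hav, MultilinearMap.map_smul_univ, MultilinearMap.map_smul_univ, hv, ha,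
      Equiv.Perm.sign_mul, Equiv.Perm.sign_swap hij]
    simp
  have hsum := Equiv.sum_comp (Equiv.mulRight (Equiv.swap i j))
    fun σ : Equiv.Perm (Fin n) =>
      (Equiv.Perm.sign σ : ℤ) • w (fun k => T.component k (o k) (f (σ k)))
  simp only [Equiv.coe_mulRight, hterm, Finset.sum_neg_distrib] at hsum
  have : IsAddTorsionFree W := .of_module_rat _
  exact self_eq_neg.1 hsum.symm

end SeparatingFamily

end Separating

/-! ### Surjectivity and injectivity -/

section Isomorphism

variable {K : Type u} [Field K] {X : SmoothProjectiveCurve K} {n : ℕ}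

/-- A finite set of codimension one points containing the zeros and poles of finitely many
functions. -/
theorem exists_finset_supportedIn {ι : Type*} (J : Finset ι) (f : ι → RatFun X) :
    ∃ S : Finset X.toScheme, (∀ y ∈ S, Order.coheight y = 1) ∧
      ∀ j ∈ J, Additive.ofMul (f j) ∈ supportedIn X (S : Set X.toScheme) := by
  classical
  refine ⟨J.biUnion fun j => (finite_divSupport (f j)).toFinset, fun y hy => ?_, fun j hj => ?_⟩
  · obtain ⟨j, -, h⟩ := Finset.mem_biUnion.1 hy
    exact coheight_of_mem_divSupport ((Set.Finite.mem_toFinset _).1 h)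
  · refine mem_supportedIn_iff.2 fun y hy => ?_
    exact Finset.mem_coe.2 (Finset.mem_biUnion.2 ⟨j, hj, (Set.Finite.mem_toFinset _).2 hy⟩)

/-- The wedge product as a multilinear map over the integers. -/
def wedgeMultilinear (X : SmoothProjectiveCurve K) (n : ℕ) :
    MultilinearMap ℤ (fun _ : Fin n => Additive (RatFun X)) (⋀[ℚ]^n (RatFunQ X)) :=
  ((exteriorPower.ιMulti ℚ n (M := RatFunQ X)).toMultilinearMap.restrictScalars ℤ).compLinearMap
    fun _ => TensorProduct.mk ℤ ℚ (Additive (RatFun X)) 1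

theorem wedgeMultilinear_apply (f : Fin n → Additive (RatFun X)) :
    wedgeMultilinear X n f = wedge X n fun i => (f i).toMul := rfl

theorem wedge_perm (f : Fin n → RatFun X) (σ : Equiv.Perm (Fin n)) :
    wedge X n (fun i => f (σ i)) = (Equiv.Perm.sign σ : ℤ) • wedge X n f :=
  AlternatingMap.map_perm (exteriorPower.ιMulti ℚ n)
    (fun i => (1 : ℚ) ⊗ₜ[ℤ] Additive.ofMul (f i)) σ

theorem wedge_mem_range [Infinite K] (f : Fin n → RatFun X) :
    wedge X n f ∈ LinearMap.range (theta X n) := by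
  classical
  obtain ⟨S, hS, hf⟩ := exists_finset_supportedIn Finset.univ f
  obtain ⟨T⟩ := nonempty_separatingFamily n hS
  let w := wedgeMultilinear X n
  let c (o : Fin n → Option S) (σ : Equiv.Perm (Fin n)) : ⋀[ℚ]^n (RatFunQ X) :=
    (Equiv.Perm.sign σ : ℤ) • w fun k => T.component k (o k) (Additive.ofMul (f (σ k)))
  -- The sign in `c` cancels the sign from reordering the wedge, so every permutation gives the same
  -- sum.
  have h1 (σ : Equiv.Perm (Fin n)) : ∑ o : Fin n → Option S, c o σ = T.M ^ n • wedge X n f := by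
    have hsum := w.map_sum fun k (o : Option S) => T.component k o (Additive.ofMul (f (σ k)))
    simp only [T.sum_component] at hsum
    simp only [c]
    rw [← Finset.smul_sum, ← hsum]
    rw [MultilinearMap.map_smul_univ, Finset.prod_const, Finset.card_univ, Fintype.card_fin]
    simp only [w, wedgeMultilinear_apply, toMul_ofMul]
    rw [wedge_perm, smul_comm, smul_smul (Equiv.Perm.sign σ : ℤ), ← Units.val_mul,
      Int.units_mul_self, Units.val_one, one_smul]
  have h2 : ∑ σ, ∑ o : Fin n → Option S, c o σ = (n.factorial * T.M ^ n : ℤ) • wedge X n f := by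
    simp only [h1]
    rw [Finset.sum_const, Finset.card_univ, Fintype.card_perm, Fintype.card_fin, mul_smul,
      natCast_zsmul]
  have h3 : ∑ σ, ∑ o : Fin n → Option S, c o σ ∈ LinearMap.range (theta X n) := by
    rw [Finset.sum_comm]
    refine Submodule.sum_mem _ fun o _ => ?_
    by_cases ho : SeparatingFamily.IsGood o
    · refine Submodule.sum_mem _ fun σ _ => zsmul_mem ?_ _
      exact ⟨_, T.theta_componentSymbol ho fun k => ⟨_, hf (σ k) (Finset.mem_univ _)⟩⟩
    · rw [T.sum_perm_eq_zero w (fun k => Additive.ofMul (f k)) ho]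
      exact zero_mem _
  rw [h2, ← Int.cast_smul_eq_zsmul ℚ] at h3
  refine (Submodule.smul_mem_iff _ ?_).1 h3
  exact_mod_cast mul_ne_zero (Int.natCast_ne_zero.2 n.factorial_ne_zero) (pow_ne_zero n T.M_ne_zero)

theorem theta_surjective [Infinite K] : Function.Surjective (theta X n) := by
  rw [← LinearMap.range_eq_top, eq_top_iff]
  let s : Set (RatFunQ X) := Set.range fun f : RatFun X => (1 : ℚ) ⊗ₜ[ℤ] Additive.ofMul f
  have hs : Submodule.span ℚ s = ⊤ := by
    rw [eq_top_iff]
    rintro z -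
    induction z using TensorProduct.induction_on with
    | zero => exact zero_mem _
    | add x y hx hy => exact add_mem hx hy
    | tmul q f =>
      have : q ⊗ₜ[ℤ] f = q • ((1 : ℚ) ⊗ₜ[ℤ] f) := by
        rw [TensorProduct.smul_tmul', smul_eq_mul, mul_one]
      rw [this]
      exact Submodule.smul_mem _ _ (Submodule.subset_span ⟨f.toMul, rfl⟩)
  rw [← exteriorPower.ιMulti_span_of_span ℚ (n := n) _ hs, Submodule.span_le]
  rintro _ ⟨a, ha, rfl⟩
  choose f hf using fun i => ha (Set.mem_range_self i)
  rw [← funext hf]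
  exact wedge_mem_range f

/-- The extended symbol need not be alternating, so it is alternatized; on a disjoint tuple all `n!`
signed terms agree, because symbols are already antisymmetric. -/
theorem exists_leftInverse_symbol {S : Finset X.toScheme} (T : SeparatingFamily X n S) :
    ∃ L : ⋀[ℚ]^n (RatFunQ X) →ₗ[ℚ] V X n, ∀ f : DisjointTuple X n,
      (∀ i, Additive.ofMul (f.fn i) ∈ supportedIn X (S : Set X.toScheme)) →
        L (wedge X n f.fn) = ((n.factorial * T.M ^ n : ℤ) : ℚ) • symbol f := by
  classical
  obtain ⟨E, hE⟩ := exists_multilinear_baseChange (supportedIn X (S : Set X.toScheme)) (V X n) n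
  let ι : ℚ ⊗[ℤ] supportedIn X (S : Set X.toScheme) →ₗ[ℚ] RatFunQ X :=
    (Submodule.subtype (supportedIn X (S : Set X.toScheme))).baseChange ℚ
  have hι : Function.Injective ι :=
    Module.Flat.lTensor_preserves_injective_linearMap _ (Submodule.subtype_injective _)
  -- Flatness of ℚ over ℤ makes `ι` injective; the linear retraction `r` extends the map to all
  -- functions.
  obtain ⟨r, hr⟩ := ι.exists_leftInverse_of_injective (LinearMap.ker_eq_bot.2 hι)
  refine ⟨exteriorPower.alternatingMapLinearEquiv
    ((MultilinearMap.alternatization (E T.extendedSymbol)).compLinearMap r), fun f hf => ?_⟩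
  have hrf (i : Fin n) : r ((1 : ℚ) ⊗ₜ[ℤ] Additive.ofMul (f.fn i)) = (1 : ℚ) ⊗ₜ[ℤ] ⟨_, hf i⟩ :=
    LinearMap.congr_fun hr ((1 : ℚ) ⊗ₜ[ℤ] (⟨_, hf i⟩ : supportedIn X (S : Set X.toScheme)))
  have hσ (σ : Equiv.Perm (Fin n)) :
      Equiv.Perm.sign σ • E T.extendedSymbol (fun i => (1 : ℚ) ⊗ₜ[ℤ] ⟨_, hf (σ i)⟩) =
        ((T.M ^ n : ℤ) : ℚ) • symbol f := by
    rw [hE]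
    refine (congrArg (Equiv.Perm.sign σ • ·)
      (T.extendedSymbol_apply (f.perm σ) fun i => hf (σ i))).trans ?_
    rw [symbol_perm, Units.smul_def, ← Int.cast_smul_eq_zsmul ℚ, smul_smul, smul_smul, mul_right_comm,
      mul_comm, ← Int.cast_mul, ← Units.val_mul, Int.units_mul_self, Units.val_one, Int.cast_one,
      mul_one]
  rw [wedge, exteriorPower.alternatingMapLinearEquiv_apply_ιMulti, AlternatingMap.compLinearMap_apply,
    MultilinearMap.alternatization_apply]
  simp only [MultilinearMap.domDomCongr_apply, hrf, hσ]
  rw [Finset.sum_const, Finset.card_univ, Fintype.card_perm, Fintype.card_fin, Int.cast_mul,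
    mul_smul, Int.cast_natCast, Nat.cast_smul_eq_nsmul]

theorem theta_injective [Infinite K] : Function.Injective (theta X n) := by
  rw [← LinearMap.ker_eq_bot, LinearMap.ker_eq_bot']
  intro v hv
  obtain ⟨c, rfl⟩ := Submodule.Quotient.mk_surjective _ v
  obtain ⟨S, hS, hf⟩ := exists_finset_supportedIn (c.support ×ˢ (Finset.univ : Finset (Fin n)))
    fun p => p.1.fn p.2
  obtain ⟨T⟩ := nonempty_separatingFamily n hS
  obtain ⟨L, hL⟩ := exists_leftInverse_symbol T
  have hc : (Submodule.Quotient.mk c : V X n) = c.sum fun f q => q • symbol f := by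
    conv_lhs => rw [← c.sum_single]
    rw [← Submodule.mkQ_apply, Finsupp.sum, map_sum]
    refine Finset.sum_congr rfl fun f _ => ?_
    change _ = c f • Submodule.mkQ _ (Finsupp.single f 1)
    rw [← map_smul, Finsupp.smul_single_one]
  rw [hc] at hv ⊢
  have h : L (theta X n (c.sum fun f q => q • symbol f)) =
      ((n.factorial * T.M ^ n : ℤ) : ℚ) • c.sum fun f q => q • symbol f := by
    simp only [Finsupp.sum, map_sum, map_smul, Finset.smul_sum, theta_symbol]
    refine Finset.sum_congr rfl fun f hfc => ?_
    rw [hL f fun i => hf (f, i) (Finset.mk_mem_product hfc (Finset.mem_univ i)), smul_comm]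
  rw [hv, map_zero] at h
  refine (smul_eq_zero.1 h.symm).resolve_left ?_
  exact_mod_cast mul_ne_zero (Int.natCast_ne_zero.2 n.factorial_ne_zero) (pow_ne_zero n T.M_ne_zero)

end Isomorphism

end DisjointDivisors

end

theorem mainTheorem11 {K : Type*} [Field K] [CharZero K]
    (X : DisjointDivisors.SmoothProjectiveCurve K) (n : ℕ) :
    Function.Bijective (DisjointDivisors.theta X n) :=
  ⟨DisjointDivisors.theta_injective, DisjointDivisors.theta_surjective⟩
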